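/- Let $\lambda,\mu>0$, $\rho=\lambda/\mu$, and let $K\ge 0$ be an integer. Let $\{Q(t)\}_{t\ge 0}$ be the queue length process of the stationary M/M/1/K queue with arrival rate $\lambda$, service rate $\mu$ and total capacity $K$; that is, $Q$ is a continuous-time Markov chain on $\{0,1,\dots,K\}$ with right-continuous paths having left limits, with transition rates $\lambda$ from $i$ to $i+1$ ($0\le i<K$) and $\mu$ from $i$ to $i-1$ ($0<i\le K$), such that the law of $Q(0)$ is the stationary distribution of the chain. Let $D(t)$ be the number of customers served in $(0,t]$, i.e. the number of downward jumps of $Q$ in $(0,t]$. Then $D(t)$ is integrable for every $t\ge 0$, and \[ \lim_{t\to\infty}\operatorname{Cov}\big(D(t),Q(t)\big)= \rho^{K+1}\left\{\frac{K^2(\rho-1)^2\left(1+3\rho^{K+1}\right)-2\rho\left(\rho^K-1\right)\left(-2+\rho+\rho^{K+2}\right)}{2(\rho-1)^2\left(\rho^{K+1}-1\right)^3}+\frac{K(\rho-1)\left(-1+3\rho-7\rho^{K+1}+5\rho^{K+2}\right)}{2(\rho-1)^2\left(\rho^{K+1}-1\right)^3}\right\} \] if $\rho\ne 1$, while \[ \lim_{t\to\infty}\operatorname{Cov}\big(D(t),Q(t)\big)=-\frac{K(K+2)}{24}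 \] if $\rho=1$. -/

import Mathlib

open MeasureTheory ProbabilityTheory Filter Topology
open scoped NNReal

/-- The generator matrix of the queue length of the M/M/1/K queue with arrival rate `lam` and
service rate `mu`, on the state space `{0, …, K}`: rate `lam` for `i → i + 1`, rate `mu` for
`i → i - 1`, and diagonal entries making every row sum vanish. -/
def mm1kGenerator (K : ℕ) (lam mu : ℝ) : Matrix (Fin (K + 1)) (Fin (K + 1)) ℝ :=
  Matrix.of fun i j =>
    if (j : ℕ) = (i : ℕ) + 1 then lam
    else if (i : ℕ) = (j : ℕ) + 1 then mu
    else if i = j then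
      -((if (i : ℕ) < K then lam else 0) + (if 0 < (i : ℕ) then mu else 0))
    else 0

/-- `X` is (under `P`) a continuous-time Markov chain on the finite state space `S` with generator
matrix `G` and with arbitrary initial law: its finite-dimensional distributions are those of the
Markov chain with transition matrices `exp (t G)`, and almost every path is a right-continuous
step function with left limits. -/
structure IsMarkovChainWithGenerator {Ω S : Type*} [MeasurableSpace Ω] [Fintype S] [DecidableEq S]
    (G : Matrix S S ℝ) (P : Measure Ω) (X : ℝ≥0 → Ω → S) : Prop where
  measurableSet_eq : ∀ (t : ℝ≥0) (i : S), MeasurableSet {ω | X t ω = i}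
  markov : ∀ (n : ℕ) (t : Fin (n + 1) → ℝ≥0) (i : Fin (n + 1) → S), Monotone t →
    P.real {ω | ∀ k, X (t k) ω = i k} =
      P.real {ω | X (t 0) ω = i 0} *
        ∏ k : Fin n,
          (NormedSpace.exp (((t k.succ : ℝ) - (t k.castSucc : ℝ)) • G) : Matrix S S ℝ)
            (i k.castSucc) (i k.succ)
  right_continuous : ∀ᵐ ω ∂P, ∀ t : ℝ≥0, ∀ᶠ s in 𝓝[>] t, X s ω = X t ω
  left_limits : ∀ᵐ ω ∂P, ∀ t : ℝ≥0, 0 < t → ∃ i : S, ∀ᶠ s in 𝓝[<] t, X s ω = i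

/-- `Q` is the queue length process of a stationary M/M/1/K queue: a Markov chain with the M/M/1/K
generator, whose initial law `θ` is a stationary distribution, `θ G = 0`. -/
structure IsStationaryMM1K {Ω : Type*} [MeasurableSpace Ω] (K : ℕ) (lam mu : ℝ) (P : Measure Ω)
    (Q : ℝ≥0 → Ω → Fin (K + 1)) : Prop where
  markovChain : IsMarkovChainWithGenerator (mm1kGenerator K lam mu) P Q
  stationary : Matrix.vecMul (fun i => P.real {ω | Q 0 ω = i}) (mm1kGenerator K lam mu) = 0

/-- The departure process `D(t)`: the number of served customers in `(0, t]`, that is, the number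
of times `s ∈ (0, t]` at which the queue length jumps down. (Downward jumps of the M/M/1/K queue
have size one almost surely, so each of them is the departure of one customer.) -/
noncomputable def departures {Ω : Type*} {K : ℕ} (Q : ℝ≥0 → Ω → Fin (K + 1)) (t : ℝ≥0) (ω : Ω) :
    ℕ :=
  Set.ncard {s : ℝ≥0 | 0 < s ∧ s ≤ t ∧ ∀ᶠ r in 𝓝[<] s, Q s ω < Q r ω}

/-! ### Counting downward jumps of a step path along partitions. -/

section Paths

/-! Let `G` be the generator, `L` its strictly lower triangular part and `θ` the stationary law. A
downward jump near time `s` contributes `θ L exp((t - s)G) g` per unit time to the mean of `D(t)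
g(Q(t))`. For `g = G w` the integral over `s` is explicit, giving `θ L (exp(tG) w - w)`
(`integral_departures_mul_mulVec`). The rigorous version counts descents along dyadic partitions:
these counts increase and are eventually equal to `D(t)`, so monotone convergence gives
integrability and dominated convergence the joint moment.

Detailed balance makes `θ L` equal to `lam θ`, except that its last entry is `0`
(`dotProduct_strictLower_mm1kGenerator_mulVec`). Since `exp(tG) w - w` has `θ`-mean zero, only the
boundary term at `K` survives. Choosing `w` with `(G w) i = m - i`, which forces `m` to be the
stationary mean, turns the covariance into `lam θ_K ((exp(tG) w)_K - w_K)`.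

A Poincaré inequality makes the semigroup converge to equilibrium
(`tendsto_exp_mm1kGenerator_mulVec`), so the limit is `lam θ_K (θ·w - w_K)`. Explicit solutions of
the Poisson equation and finite power sums then evaluate it. -/

theorem exists_local_step {S : Type*} {x : ℝ≥0 → S} (hr : ∀ t, ∀ᶠ s in 𝓝[>] t, x s = x t)
    (hl : ∀ t, 0 < t → ∃ i, ∀ᶠ s in 𝓝[<] t, x s = i) (s : ℝ≥0) :
    ∃ i, ∀ᶠ r in 𝓝 s, (r < s → x r = i) ∧ (s ≤ r → x r = x s) := by
  have h1 := eventually_nhdsWithin_iff.1 (hr s)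
  have h2 : ∃ i, ∀ᶠ r in 𝓝 s, r < s → x r = i := by
    rcases eq_or_ne s 0 with rfl | h0
    · exact ⟨x 0, Eventually.of_forall fun r hr => absurd hr not_lt_zero⟩
    · obtain ⟨i, hi⟩ := hl s (pos_iff_ne_zero.2 h0)
      exact ⟨i, eventually_nhdsWithin_iff.1 hi⟩
  obtain ⟨i, hi⟩ := h2
  refine ⟨i, ?_⟩
  filter_upwards [h1, hi] with r hr1 hr2
  refine ⟨hr2, fun h => ?_⟩
  rcases h.eq_or_lt with rfl | h
  · rfl
  · exact hr1 h

variable {S : Type*} [LinearOrder S]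

/-- The set of times at which a path jumps down. -/
def downJumps (x : ℝ≥0 → S) : Set ℝ≥0 := {s | ∀ᶠ r in 𝓝[<] s, x s < x r}

/-- The number of descents of a path between consecutive points of the uniform partition of
`[0, t]` into `n` intervals. -/
noncomputable def gridDescents (x : ℝ≥0 → S) (t : ℝ≥0) (n : ℕ) : ℕ :=
  ∑ k ∈ Finset.range n, if x (t * ((k + 1 : ℕ) / n)) < x (t * ((k : ℕ) / n)) then 1 else 0

/-- The point `c < r` matters: the left neighbourhood filter at `0` is trivial, so `0` lies in
`downJumps x` vacuously. Hence jumps are only ever counted in half-open intervals `Ioc`. -/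
theorem notMem_downJumps_of_eq {x : ℝ≥0 → S} {c r : ℝ≥0} (hc : c < r)
    (h : ∀ s, c ≤ s → s < r → x s = x r) : r ∉ downJumps x := by
  intro hr
  have hne : (𝓝[<] r).NeBot := nhdsLT_neBot_of_exists_lt ⟨c, hc⟩
  have h1 : ∀ᶠ s in 𝓝[<] r, s ∈ Set.Ioo c r := Ioo_mem_nhdsLT hc
  obtain ⟨s, hs, hs'⟩ := (h1.and hr).exists
  rw [h s hs.1.le hs.2] at hs'
  exact lt_irrefl _ hs'

/-- With a single possible break point `s`, the only candidate for a jump is `s`, and it lies in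
`Ioc a b` exactly when the endpoints are on different sides of it. -/
theorem downJumps_inter_Ioc {x : ℝ≥0 → S} {a b s : ℝ≥0} {i : S} (hab : a ≤ b)
    (h : ∀ r, a ≤ r → r ≤ b → (r < s → x r = i) ∧ (s ≤ r → x r = x s)) :
    (downJumps x ∩ Set.Ioc a b).Finite ∧
      (downJumps x ∩ Set.Ioc a b).ncard = if x b < x a then 1 else 0 := by
  have hother : ∀ r ∈ downJumps x ∩ Set.Ioc a b, r = s ∧ a < s ∧ s ≤ b := by
    rintro r ⟨hr, har, hrb⟩
    rcases lt_trichotomy r s with hrs | hrs | hrs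
    · refine absurd hr (notMem_downJumps_of_eq har fun q hq hqr => ?_)
      rw [(h q hq (hqr.le.trans hrb)).1 (hqr.trans hrs), (h r har.le hrb).1 hrs]
    · exact ⟨hrs, hrs ▸ har, hrs ▸ hrb⟩
    · refine absurd hr (notMem_downJumps_of_eq (max_lt har hrs) fun q hq hqr => ?_)
      rw [(h q ((le_max_left _ _).trans hq) (hqr.le.trans hrb)).2 ((le_max_right _ _).trans hq),
        (h r har.le hrb).2 hrs.le]
  by_cases hs : a < s ∧ s ≤ b
  · have hxa : x a = i := (h a le_rfl hab).1 hs.1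
    have hxb : x b = x s := (h b hab le_rfl).2 hs.2
    have hev : ∀ᶠ r in 𝓝[<] s, x r = i := by
      filter_upwards [Ioo_mem_nhdsLT hs.1] with r hr
      exact (h r hr.1.le (hr.2.le.trans hs.2)).1 hr.2
    by_cases hlt : x b < x a
    · have : downJumps x ∩ Set.Ioc a b = {s} := by
        ext r
        refine ⟨fun hr => (hother r hr).1, ?_⟩
        rintro rfl
        refine ⟨?_, hs⟩
        filter_upwards [hev] with q hq
        rw [hq, ← hxa, ← hxb]
        exact hlt
      rw [this, if_pos hlt]
      exact ⟨Set.finite_singleton s, Set.ncard_singleton s⟩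
    · have : downJumps x ∩ Set.Ioc a b = ∅ := by
        rw [Set.eq_empty_iff_forall_notMem]
        intro r hr
        obtain rfl := (hother r hr).1
        have hne : (𝓝[<] r).NeBot := nhdsLT_neBot_of_exists_lt ⟨a, hs.1⟩
        obtain ⟨q, hq, hq'⟩ := (hev.and hr.1).exists
        rw [hq, ← hxa, ← hxb] at hq'
        exact hlt hq'
      rw [this, if_neg hlt]
      exact ⟨Set.finite_empty, Set.ncard_empty _⟩
  · have : downJumps x ∩ Set.Ioc a b = ∅ := by
      rw [Set.eq_empty_iff_forall_notMem]
      exact fun r hr => hs (hother r hr).2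
    have hlt : ¬ x b < x a := by
      rw [not_and_or, not_lt, not_le] at hs
      rcases hs with hs | hs
      · rw [(h a le_rfl hab).2 hs, (h b hab le_rfl).2 (hs.trans hab)]
        exact lt_irrefl _
      · rw [(h a le_rfl hab).1 (hab.trans_lt hs), (h b hab le_rfl).1 hs]
        exact lt_irrefl _
    rw [this, if_neg hlt]
    exact ⟨Set.finite_empty, Set.ncard_empty _⟩

/-- Every time has a neighbourhood with at most one break; `δ` is a Lebesgue number of this cover of
the compact interval `[0, t]`. -/
theorem exists_mesh {x : ℝ≥0 → S} (hr : ∀ t, ∀ᶠ s in 𝓝[>] t, x s = x t)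
    (hl : ∀ t, 0 < t → ∃ i, ∀ᶠ s in 𝓝[<] t, x s = i) (t : ℝ≥0) :
    ∃ δ : ℝ, 0 < δ ∧ ∀ a b : ℝ≥0, a ≤ b → b ≤ t → (b : ℝ) - a < δ →
      (downJumps x ∩ Set.Ioc a b).Finite ∧
        (downJumps x ∩ Set.Ioc a b).ncard = if x b < x a then 1 else 0 := by
  choose i hi using exists_local_step hr hl
  obtain ⟨δ, hδ, h⟩ := lebesgue_number_lemma_of_metric (isCompact_Icc (a := (0 : ℝ≥0)) (b := t))
    (c := fun s => interior {r | (r < s → x r = i s) ∧ (s ≤ r → x r = x s)})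
    (fun s => isOpen_interior)
    (fun s _ => Set.mem_iUnion.2 ⟨s, mem_interior_iff_mem_nhds.2 (hi s)⟩)
  refine ⟨δ, hδ, fun a b hab hbt hlt => ?_⟩
  obtain ⟨s, hs⟩ := h a ⟨zero_le, hab.trans hbt⟩
  refine downJumps_inter_Ioc (s := s) (i := i s) hab fun r har hrb => ?_
  suffices hmem : r ∈ Metric.ball a δ from
    (interior_subset (hs hmem) : r ∈ {r | (r < s → x r = i s) ∧ (s ≤ r → x r = x s)})
  rw [Metric.mem_ball, NNReal.dist_eq, abs_of_nonneg (sub_nonneg.2 (by exact_mod_cast har))]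
  have : (r : ℝ) ≤ b := by exact_mod_cast hrb
  linarith

theorem ncard_downJumps_Ioc_grid {x : ℝ≥0 → S} (u : ℕ → ℝ≥0) (hu : Monotone u) (n : ℕ)
    (h : ∀ k < n, (downJumps x ∩ Set.Ioc (u k) (u (k + 1))).Finite ∧
        (downJumps x ∩ Set.Ioc (u k) (u (k + 1))).ncard =
          if x (u (k + 1)) < x (u k) then 1 else 0) :
    (downJumps x ∩ Set.Ioc (u 0) (u n)).Finite ∧
      (downJumps x ∩ Set.Ioc (u 0) (u n)).ncard =
        ∑ k ∈ Finset.range n, if x (u (k + 1)) < x (u k) then 1 else 0 := by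
  induction n with
  | zero => simp
  | succ n ih =>
    obtain ⟨f1, c1⟩ := ih fun k hk => h k (hk.trans n.lt_succ_self)
    obtain ⟨f2, c2⟩ := h n n.lt_succ_self
    have hun : downJumps x ∩ Set.Ioc (u 0) (u (n + 1)) =
        (downJumps x ∩ Set.Ioc (u 0) (u n)) ∪ (downJumps x ∩ Set.Ioc (u n) (u (n + 1))) := by
      rw [← Set.inter_union_distrib_left,
        Set.Ioc_union_Ioc_eq_Ioc (hu (Nat.zero_le n)) (hu n.le_succ)]
    have hdisj : Disjoint (downJumps x ∩ Set.Ioc (u 0) (u n))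
        (downJumps x ∩ Set.Ioc (u n) (u (n + 1))) := by
      rw [Set.disjoint_left]
      exact fun r h1 h2 => absurd h2.2.1 (not_lt.2 h1.2.2)
    rw [hun, Set.ncard_union_eq hdisj f1 f2, c1, c2, Finset.sum_range_succ]
    exact ⟨f1.union f2, rfl⟩

/-- The descents along a fine uniform partition count the downward jumps exactly. -/
theorem eventually_gridDescents_eq {x : ℝ≥0 → S} (hr : ∀ t, ∀ᶠ s in 𝓝[>] t, x s = x t)
    (hl : ∀ t, 0 < t → ∃ i, ∀ᶠ s in 𝓝[<] t, x s = i) (t : ℝ≥0) :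
    ∀ᶠ n : ℕ in atTop, gridDescents x t n = (downJumps x ∩ Set.Ioc 0 t).ncard := by
  obtain ⟨δ, hδ, h⟩ := exists_mesh hr hl t
  have ht : Tendsto (fun n : ℕ => (t : ℝ) / n) atTop (𝓝 0) :=
    tendsto_const_div_atTop_nhds_zero_nat _
  filter_upwards [ht.eventually (gt_mem_nhds hδ), eventually_gt_atTop 0] with n hn hn0
  have hn0' : (n : ℝ≥0) ≠ 0 := by exact_mod_cast hn0.ne'
  have hmono : Monotone fun k : ℕ => t * ((k : ℝ≥0) / n) := by
    intro a b hab
    have : (a : ℝ≥0) ≤ b := by exact_mod_cast hab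
    dsimp only
    gcongr
  have key := (ncard_downJumps_Ioc_grid (x := x) (fun k : ℕ => t * ((k : ℝ≥0) / n)) hmono n
    fun k hk => ?_).2
  · simp only [Nat.cast_zero, zero_div, mul_zero, div_self hn0', mul_one] at key
    rw [key]
    rfl
  · refine h _ _ (hmono k.le_succ) ?_ ?_
    · have := hmono (Nat.succ_le_of_lt hk)
      simpa [div_self hn0'] using this
    · have hnr : (n : ℝ) ≠ 0 := by exact_mod_cast hn0.ne'
      have : ((t * (((k + 1 : ℕ) : ℝ≥0) / n) : ℝ≥0) : ℝ) - ((t * ((k : ℝ≥0) / n) : ℝ≥0) : ℝ)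
          = t / n := by
        push_cast
        field_simp
        ring
      rw [this]
      exact hn

theorem sum_range_two_mul {M : Type*} [AddCommMonoid M] (f : ℕ → M) (n : ℕ) :
    ∑ k ∈ Finset.range (2 * n), f k =
      ∑ k ∈ Finset.range n, (f (2 * k) + f (2 * k + 1)) := by
  induction n with
  | zero => simp
  | succ n ih =>
    rw [mul_add, mul_one, Finset.sum_range_succ, Finset.sum_range_succ, ih, Finset.sum_range_succ,
      add_assoc]

/-- Halving the partition can only increase the number of descents. -/
theorem gridDescents_le_two_mul (x : ℝ≥0 → S) (t : ℝ≥0) (n : ℕ) :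
    gridDescents x t n ≤ gridDescents x t (2 * n) := by
  unfold gridDescents
  rw [sum_range_two_mul]
  refine Finset.sum_le_sum fun k _ => ?_
  have e : ∀ j : ℕ, (((2 * j : ℕ) : ℝ≥0) / ((2 * n : ℕ) : ℝ≥0)) = (j : ℝ≥0) / n := by
    intro j
    push_cast
    rw [mul_div_mul_left _ _ (two_ne_zero)]
  rw [show 2 * k + 1 + 1 = 2 * (k + 1) by ring, e, e]
  set a := x (t * ((k : ℝ≥0) / n))
  set b := x (t * (((2 * k + 1 : ℕ) : ℝ≥0) / ((2 * n : ℕ) : ℝ≥0)))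
  set c := x (t * (((k + 1 : ℕ) : ℝ≥0) / n))
  -- A descent from `a` to `c` through the midpoint value `b` forces `b < a` or `c < b`.
  by_cases hca : c < a
  · rcases lt_or_ge b a with hb | hb
    · simp [hca, hb]
    · simp [hca, hca.trans_le hb]
  · simp [hca]

theorem monotone_gridDescents_two_pow (x : ℝ≥0 → S) (t : ℝ≥0) :
    Monotone fun m : ℕ => gridDescents x t (2 ^ m) :=
  monotone_nat_of_le_succ fun m => by
    rw [pow_succ']
    exact gridDescents_le_two_mul x t _

end Paths

/-! ### Limits of the matrix semigroup along uniform partitions. -/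

section MatrixSemigroup

variable {S : Type*} [Fintype S] [DecidableEq S]

open scoped Matrix.Norms.Operator in
theorem hasDerivAt_matrix_exp_smul (G : Matrix S S ℝ) (t : ℝ) :
    HasDerivAt (fun s : ℝ => (NormedSpace.exp (s • G) : Matrix S S ℝ))
      (G * NormedSpace.exp (t • G)) t :=
  hasDerivAt_exp_smul_const' G t

theorem exp_smul_pow (G : Matrix S S ℝ) (s : ℝ) (k : ℕ) :
    (NormedSpace.exp (s • G) : Matrix S S ℝ) ^ k = NormedSpace.exp ((k * s) • G) := by
  rw [← Matrix.exp_nsmul, mul_smul, Nat.cast_smul_eq_nsmul]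

open scoped Matrix.Norms.Operator in
theorem tendsto_nat_smul_exp_sub_one (G : Matrix S S ℝ) (t : ℝ) :
    Tendsto (fun n : ℕ => (n : ℝ) • ((NormedSpace.exp ((t / n) • G) : Matrix S S ℝ) - 1)) atTop
      (𝓝 (t • G)) := by
  have h := hasDerivAt_iff_tendsto_slope_zero.1 (hasDerivAt_matrix_exp_smul (t • G) 0)
  have hn : Tendsto (fun n : ℕ => (n : ℝ)⁻¹) atTop (𝓝[≠] 0) := by
    refine tendsto_nhdsWithin_iff.2 ⟨tendsto_inv_atTop_nhds_zero_nat, ?_⟩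
    filter_upwards [eventually_gt_atTop 0] with n hn
    exact inv_ne_zero (by exact_mod_cast hn.ne')
  have h2 := h.comp hn
  simp only [zero_smul, NormedSpace.exp_zero, mul_one] at h2
  refine h2.congr fun n => ?_
  simp only [Function.comp_apply, inv_inv, zero_add, smul_smul]
  rw [inv_mul_eq_div]

open scoped Matrix.Norms.Operator in
/-- Riemann sums of the semigroup generated by `G`, applied to the range of `G`. -/
theorem tendsto_average_exp_mul (G : Matrix S S ℝ) {t : ℝ} (ht : 0 ≤ t) :
    Tendsto (fun n : ℕ => ((n : ℝ)⁻¹ • ∑ k ∈ Finset.range n,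
      (NormedSpace.exp ((t / n) • G) : Matrix S S ℝ) ^ k) * (t • G)) atTop
      (𝓝 (NormedSpace.exp (t • G) - 1)) := by
  have hcont : Continuous fun s : ℝ => (NormedSpace.exp (s • G) : Matrix S S ℝ) :=
    continuous_iff_continuousAt.2 fun s => (hasDerivAt_matrix_exp_smul G s).continuousAt
  obtain ⟨C, hC⟩ := (isCompact_Icc (a := (0 : ℝ)) (b := t)).exists_bound_of_continuousOn
    hcont.continuousOn
  set R : ℕ → Matrix S S ℝ := fun n => (n : ℝ)⁻¹ • ∑ k ∈ Finset.range n,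
      (NormedSpace.exp ((t / n) • G) : Matrix S S ℝ) ^ k with hR
  set B : ℕ → Matrix S S ℝ :=
    fun n => (n : ℝ) • ((NormedSpace.exp ((t / n) • G) : Matrix S S ℝ) - 1) with hB
  have hbound : ∀ n : ℕ, 0 < n → ‖R n‖ ≤ C := by
    intro n hn
    have hn' : (0 : ℝ) < n := by exact_mod_cast hn
    have : ‖∑ k ∈ Finset.range n, (NormedSpace.exp ((t / n) • G) : Matrix S S ℝ) ^ k‖ ≤ n * C := by
      refine (norm_sum_le_of_le (f := fun k => (NormedSpace.exp ((t / n) • G) : Matrix S S ℝ) ^ k)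
        (n := fun _ => C) _ fun k hk => ?_).trans ?_
      · rw [exp_smul_pow]
        refine hC _ ⟨by positivity, ?_⟩
        have hk' : (k : ℝ) ≤ n := by exact_mod_cast (Finset.mem_range.1 hk).le
        calc (k : ℝ) * (t / n) ≤ n * (t / n) := by gcongr
          _ = t := by field_simp
      · simp
    rw [hR]
    calc ‖(n : ℝ)⁻¹ • ∑ k ∈ Finset.range n, (NormedSpace.exp ((t / n) • G) : Matrix S S ℝ) ^ k‖
        = (n : ℝ)⁻¹ * ‖∑ k ∈ Finset.range n,
          (NormedSpace.exp ((t / n) • G) : Matrix S S ℝ) ^ k‖ := by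
          rw [norm_smul, Real.norm_of_nonneg (by positivity)]
      _ ≤ (n : ℝ)⁻¹ * (n * C) := by gcongr
      _ = C := by field_simp
  -- The geometric sum telescopes, so the identity is exact for each `n`. Boundedness of `R n` then
  -- lets `B n` be replaced by its limit `t • G`; convergence of `R n` itself is not needed.
  have hRB : ∀ n : ℕ, 0 < n → R n * B n = NormedSpace.exp (t • G) - 1 := by
    intro n hn
    have hn' : (n : ℝ) ≠ 0 := by exact_mod_cast hn.ne'
    rw [hR, hB]
    simp only [smul_mul_assoc, mul_smul_comm, smul_smul, mul_inv_cancel₀ hn', one_smul]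
    rw [geom_sum_mul, exp_smul_pow, mul_div_cancel₀ _ hn']
  have hdiff : Tendsto (fun n => R n * (t • G - B n)) atTop (𝓝 0) := by
    have h0 : Tendsto (fun n => C * ‖t • G - B n‖) atTop (𝓝 0) := by
      have := ((tendsto_const_nhds (x := t • G)).sub (tendsto_nat_smul_exp_sub_one G t)).norm
      simpa using this.const_mul C
    refine squeeze_zero_norm' ?_ h0
    filter_upwards [eventually_gt_atTop 0] with n hn
    exact (norm_mul_le _ _).trans (by gcongr; exact hbound n hn)
  have hlim : Tendsto (fun n => R n * (t • G - B n) + R n * B n) atTop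
      (𝓝 (0 + (NormedSpace.exp (t • G) - 1))) :=
    hdiff.add (tendsto_const_nhds.congr' (by
      filter_upwards [eventually_gt_atTop 0] with n hn
      exact (hRB n hn).symm))
  rw [zero_add] at hlim
  refine hlim.congr fun n => ?_
  rw [← mul_add, sub_add_cancel]

end MatrixSemigroup

/-! ### Moments of descent counts for a stationary chain. -/

section MarkovChain

theorem hasDerivAt_matrix_exp_smul_apply {S : Type*} [Fintype S] [DecidableEq S]
    (G : Matrix S S ℝ) (t : ℝ) (i j : S) :
    HasDerivAt (fun s : ℝ => (NormedSpace.exp (s • G) : Matrix S S ℝ) i j)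
      ((G * NormedSpace.exp (t • G)) i j) t :=
  hasDerivAt_pi.1 (hasDerivAt_pi.1 (hasDerivAt_matrix_exp_smul G t) i) j

/-- A row vector annihilated by the generator is invariant under its semigroup. -/
theorem vecMul_exp_smul_of_vecMul_eq_zero {S : Type*} [Fintype S] [DecidableEq S]
    {G : Matrix S S ℝ} {θ : S → ℝ} (h : Matrix.vecMul θ G = 0) (t : ℝ) :
    Matrix.vecMul θ (NormedSpace.exp (t • G)) = θ := by
  funext j
  have hd : ∀ s : ℝ, HasDerivAt (fun s : ℝ =>
      Matrix.vecMul θ (NormedSpace.exp (s • G) : Matrix S S ℝ) j) 0 s := by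
    intro s
    have h1 : HasDerivAt (fun s : ℝ => ∑ i, θ i * (NormedSpace.exp (s • G) : Matrix S S ℝ) i j)
        (∑ i, θ i * (G * NormedSpace.exp (s • G)) i j) s :=
      HasDerivAt.fun_sum fun i _ => (hasDerivAt_matrix_exp_smul_apply G s i j).const_mul (θ i)
    have h2 : ∑ i, θ i * (G * NormedSpace.exp (s • G)) i j = 0 := by
      change Matrix.vecMul θ (G * NormedSpace.exp (s • G)) j = 0
      rw [← Matrix.vecMul_vecMul, h, Matrix.zero_vecMul, Pi.zero_apply]
    rw [h2] at h1
    exact h1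
  have := is_const_of_deriv_eq_zero (fun s => (hd s).differentiableAt) (fun s => (hd s).deriv) t 0
  rw [this, zero_smul, NormedSpace.exp_zero, Matrix.vecMul_one]

/-- The strictly lower triangular part of a matrix: the downward transitions. -/
def strictLower {S : Type*} [LinearOrder S] (M : Matrix S S ℝ) : Matrix S S ℝ :=
  Matrix.of fun i j => if j < i then M i j else 0

/-- Subtracting the identity affects only the diagonal. This allows the descent matrix `strictLower
(exp (h G))` to be read as a difference quotient of the semigroup. -/
theorem strictLower_smul_sub_one {S : Type*} [LinearOrder S] (c : ℝ) (M : Matrix S S ℝ) :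
    strictLower (c • (M - 1)) = c • strictLower M := by
  ext i j
  simp only [strictLower, Matrix.of_apply, Matrix.smul_apply, Matrix.sub_apply, smul_eq_mul]
  split_ifs with h
  · rw [Matrix.one_apply_ne h.ne', sub_zero]
  · simp

theorem continuous_strictLower {S : Type*} [LinearOrder S] :
    Continuous (strictLower : Matrix S S ℝ → Matrix S S ℝ) := by
  refine continuous_matrix fun i j => ?_
  simp only [strictLower, Matrix.of_apply]
  split_ifs
  · exact continuous_id.matrix_elem i j
  · exact continuous_const

variable {Ω : Type*} [MeasurableSpace Ω] {P : Measure Ω} {K : ℕ}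
  {G : Matrix (Fin (K + 1)) (Fin (K + 1)) ℝ} {X : ℝ≥0 → Ω → Fin (K + 1)}

theorem IsMarkovChainWithGenerator.measurable (hX : IsMarkovChainWithGenerator G P X) (t : ℝ≥0) :
    Measurable (X t) :=
  measurable_to_countable' fun i => hX.measurableSet_eq t i

theorem integral_comp_eq_sum [IsProbabilityMeasure P] {ι : Type*} [Fintype ι] [MeasurableSpace ι]
    [MeasurableSingletonClass ι] {Y : Ω → ι} (hY : Measurable Y) (f : ι → ℝ) :
    ∫ ω, f (Y ω) ∂P = ∑ y, P.real {ω | Y ω = y} * f y := by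
  have hf : Measurable f := measurable_of_finite f
  have : IsProbabilityMeasure (P.map Y) := Measure.isProbabilityMeasure_map hY.aemeasurable
  rw [← integral_map hY.aemeasurable hf.aestronglyMeasurable, integral_fintype .of_finite]
  refine Finset.sum_congr rfl fun y _ => ?_
  rw [map_measureReal_apply hY (measurableSet_singleton y)]
  rfl

theorem IsMarkovChainWithGenerator.real_two (hX : IsMarkovChainWithGenerator G P X) {s t : ℝ≥0}
    (hst : s ≤ t) (i j : Fin (K + 1)) :
    P.real {ω | X s ω = i ∧ X t ω = j} =
      P.real {ω | X s ω = i} * (NormedSpace.exp (((t : ℝ) - s) • G) : Matrix _ _ ℝ) i j := by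
  have hmono : Monotone ![s, t] := by
    rw [Fin.monotone_iff_le_succ]
    intro k
    fin_cases k
    exact hst
  have := hX.markov 1 ![s, t] ![i, j] hmono
  simpa [Fin.forall_fin_two] using this

theorem IsMarkovChainWithGenerator.real_three (hX : IsMarkovChainWithGenerator G P X)
    {r s t : ℝ≥0} (hrs : r ≤ s) (hst : s ≤ t) (i j l : Fin (K + 1)) :
    P.real {ω | X r ω = i ∧ X s ω = j ∧ X t ω = l} =
      P.real {ω | X r ω = i} * ((NormedSpace.exp (((s : ℝ) - r) • G) : Matrix _ _ ℝ) i j *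
        (NormedSpace.exp (((t : ℝ) - s) • G) : Matrix _ _ ℝ) j l) := by
  have hmono : Monotone ![r, s, t] := by
    rw [Fin.monotone_iff_le_succ]
    intro k
    fin_cases k
    · exact hrs
    · exact hst
  have := hX.markov 2 ![r, s, t] ![i, j, l] hmono
  simpa [Fin.forall_fin_succ, Fin.prod_univ_two] using this

theorem IsMarkovChainWithGenerator.integral_comp [IsProbabilityMeasure P] (hX : IsMarkovChainWithGenerator G P X)
    (hst : Matrix.vecMul (fun i => P.real {ω | X 0 ω = i}) G = 0) (t : ℝ≥0)
    (g : Fin (K + 1) → ℝ) :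
    ∫ ω, g (X t ω) ∂P = (fun i => P.real {ω | X 0 ω = i}) ⬝ᵥ g := by
  have h := integral_comp_eq_sum (P := P) ((hX.measurable 0).prodMk (hX.measurable t))
    (fun y => g y.2)
  dsimp only at h
  rw [h, Fintype.sum_prod_type, Finset.sum_comm]
  refine Finset.sum_congr rfl fun j _ => ?_
  have hinv := congrFun (vecMul_exp_smul_of_vecMul_eq_zero hst t) j
  simp only [Prod.mk.injEq, hX.real_two (zero_le (a := t))]
  rw [← Finset.sum_mul, ← hinv, NNReal.coe_zero, sub_zero]
  rfl

theorem IsMarkovChainWithGenerator.real_eq [IsProbabilityMeasure P] (hX : IsMarkovChainWithGenerator G P X)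
    (hst : Matrix.vecMul (fun i => P.real {ω | X 0 ω = i}) G = 0) (t : ℝ≥0) (i : Fin (K + 1)) :
    P.real {ω | X t ω = i} = P.real {ω | X 0 ω = i} := by
  have h := hX.integral_comp hst t (Pi.single i 1)
  rw [integral_comp_eq_sum (hX.measurable t)] at h
  simpa [Pi.single_apply] using h

/-- In the three-time law, the indicator of a descent keeps just the strictly lower entries of the
transition matrix from `r` to `s`, while stationarity makes the law at time `r` the initial one. -/
theorem IsMarkovChainWithGenerator.integral_descent_mul [IsProbabilityMeasure P] (hX : IsMarkovChainWithGenerator G P X)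
    (hst : Matrix.vecMul (fun i => P.real {ω | X 0 ω = i}) G = 0) {r s t : ℝ≥0}
    (hrs : r ≤ s) (hst' : s ≤ t) (g : Fin (K + 1) → ℝ) :
    ∫ ω, (if X s ω < X r ω then 1 else 0) * g (X t ω) ∂P =
      (fun i => P.real {ω | X 0 ω = i}) ⬝ᵥ
        Matrix.mulVec (strictLower (NormedSpace.exp (((s : ℝ) - r) • G)))
          (Matrix.mulVec (NormedSpace.exp (((t : ℝ) - s) • G)) g) := by
  have h := integral_comp_eq_sum (P := P)
    ((hX.measurable r).prodMk ((hX.measurable s).prodMk (hX.measurable t)))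
    (fun y => (if y.2.1 < y.1 then 1 else 0) * g y.2.2)
  dsimp only at h
  rw [h]
  simp only [Fintype.sum_prod_type, Prod.mk.injEq, hX.real_three hrs hst', hX.real_eq hst r,
    dotProduct, Matrix.mulVec, Finset.mul_sum, strictLower, Matrix.of_apply]
  refine Finset.sum_congr rfl fun i _ => Finset.sum_congr rfl fun j _ =>
    Finset.sum_congr rfl fun l _ => ?_
  split_ifs <;> ring

theorem IsMarkovChainWithGenerator.measurable_gridDescents
    (hX : IsMarkovChainWithGenerator G P X) (t : ℝ≥0) (n : ℕ) :
    Measurable fun ω => (gridDescents (fun s => X s ω) t n : ℝ) := by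
  unfold gridDescents
  push_cast
  refine Finset.measurable_sum _ fun k _ => Measurable.ite ?_ measurable_const measurable_const
  exact measurableSet_lt (hX.measurable _) (hX.measurable _)

theorem gridDescents_le {S : Type*} [LinearOrder S] (x : ℝ≥0 → S) (t : ℝ≥0) (n : ℕ) :
    gridDescents x t n ≤ n := by
  unfold gridDescents
  refine (Finset.sum_le_card_nsmul _ _ 1 fun k _ => ?_).trans (by simp)
  split_ifs <;> simp

theorem IsMarkovChainWithGenerator.integral_gridDescents_mul
    [IsProbabilityMeasure P] (hX : IsMarkovChainWithGenerator G P X)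
    (hst : Matrix.vecMul (fun i => P.real {ω | X 0 ω = i}) G = 0) (t : ℝ≥0) {n : ℕ}
    (hn : 0 < n) (g : Fin (K + 1) → ℝ) :
    ∫ ω, (gridDescents (fun s => X s ω) t n : ℝ) * g (X t ω) ∂P =
      (fun i => P.real {ω | X 0 ω = i}) ⬝ᵥ
        Matrix.mulVec (strictLower
          ((n : ℝ) • ((NormedSpace.exp (((t : ℝ) / n) • G) : Matrix _ _ ℝ) - 1)))
          (Matrix.mulVec ((n : ℝ)⁻¹ • ∑ k ∈ Finset.range n,
            (NormedSpace.exp (((t : ℝ) / n) • G) : Matrix _ _ ℝ) ^ k) g) := by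
  have hn' : (n : ℝ) ≠ 0 := by exact_mod_cast hn.ne'
  -- The factors `n` and `n⁻¹` cancel. The sum is reflected because after the interval with index
  -- `k` there remain `n - 1 - k` intervals up to time `t`.
  rw [strictLower_smul_sub_one, Matrix.smul_mulVec, Matrix.smul_mulVec, Matrix.mulVec_smul, smul_smul,
    mul_inv_cancel₀ hn', one_smul, Matrix.sum_mulVec, Matrix.mulVec_sum, dotProduct_sum,
    ← Finset.sum_range_reflect]
  unfold gridDescents
  push_cast
  simp only [Finset.sum_mul]
  rw [integral_finsetSum]
  · refine Finset.sum_congr rfl fun k hk => ?_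
    have hk' : k + 1 ≤ n := Finset.mem_range.1 hk
    have h1 : t * ((k : ℝ≥0) / n) ≤ t * (((k + 1 : ℕ) : ℝ≥0) / n) := by
      gcongr
      exact k.le_succ
    have h2 : t * (((k + 1 : ℕ) : ℝ≥0) / n) ≤ t := by
      refine mul_le_of_le_one_right' (div_le_one_of_le₀ (by exact_mod_cast hk') zero_le)
    have h := hX.integral_descent_mul hst h1 h2 g
    have e1 : ((t * (((k + 1 : ℕ) : ℝ≥0) / n) : ℝ≥0) : ℝ) - ((t * ((k : ℝ≥0) / n) : ℝ≥0) : ℝ)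
        = t / n := by
      push_cast
      field_simp
      ring
    have e2 : (t : ℝ) - ((t * (((k + 1 : ℕ) : ℝ≥0) / n) : ℝ≥0) : ℝ)
        = ((n - 1 - k : ℕ) : ℝ) * (t / n) := by
      rw [Nat.cast_sub (by omega), Nat.cast_sub (by omega)]
      push_cast
      field_simp
      ring
    rw [e1, e2, ← exp_smul_pow] at h
    push_cast at h
    exact h
  · intro k _
    refine Integrable.of_bound (C := ∑ i, |g i|) (Measurable.aestronglyMeasurable ?_)
      (Eventually.of_forall fun ω => ?_)
    · exact (Measurable.ite (measurableSet_lt (hX.measurable _) (hX.measurable _))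
        measurable_const measurable_const).mul ((measurable_of_finite g).comp (hX.measurable t))
    · have h1 : |g (X t ω)| ≤ ∑ i, |g i| :=
        Finset.single_le_sum (f := fun i => |g i|) (fun i _ => abs_nonneg _) (Finset.mem_univ _)
      rw [norm_mul, Real.norm_eq_abs, Real.norm_eq_abs]
      split_ifs
      · simpa using h1
      · simpa using (abs_nonneg _).trans h1

end MarkovChain

/-! ### Passage from descent counts to the departure process. -/

section Departures

theorem departures_eq_ncard {Ω : Type*} {K : ℕ} (X : ℝ≥0 → Ω → Fin (K + 1)) (t : ℝ≥0) (ω : Ω) :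
    departures X t ω = (downJumps (fun s => X s ω) ∩ Set.Ioc 0 t).ncard := by
  unfold departures
  congr 1
  ext s
  simp only [downJumps, Set.mem_inter_iff, Set.mem_Ioc, Set.mem_ofPred_eq]
  tauto

variable {Ω : Type*} [MeasurableSpace Ω] {P : Measure Ω} {K : ℕ}
  {G : Matrix (Fin (K + 1)) (Fin (K + 1)) ℝ} {X : ℝ≥0 → Ω → Fin (K + 1)}

theorem IsMarkovChainWithGenerator.ae_eventually_gridDescents_eq
    (hX : IsMarkovChainWithGenerator G P X) (t : ℝ≥0) :
    ∀ᵐ ω ∂P, ∀ᶠ m : ℕ in atTop,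
      gridDescents (fun s => X s ω) t (2 ^ m) = departures X t ω := by
  filter_upwards [hX.right_continuous, hX.left_limits] with ω h1 h2
  have h := eventually_gridDescents_eq (x := fun s => X s ω) h1 h2 t
  rw [departures_eq_ncard]
  exact (tendsto_pow_atTop_atTop_of_one_lt one_lt_two).eventually h

theorem IsMarkovChainWithGenerator.ae_gridDescents_le_departures
    (hX : IsMarkovChainWithGenerator G P X) (t : ℝ≥0) :
    ∀ᵐ ω ∂P, ∀ m : ℕ, gridDescents (fun s => X s ω) t (2 ^ m) ≤ departures X t ω := by
  filter_upwards [hX.ae_eventually_gridDescents_eq t] with ω h m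
  obtain ⟨m', h1, h2⟩ := (h.and (eventually_ge_atTop m)).exists
  rw [← h1]
  exact monotone_gridDescents_two_pow _ t h2

theorem IsMarkovChainWithGenerator.ae_tendsto_gridDescents
    (hX : IsMarkovChainWithGenerator G P X) (t : ℝ≥0) :
    ∀ᵐ ω ∂P, Tendsto (fun m : ℕ => (gridDescents (fun s => X s ω) t (2 ^ m) : ℝ)) atTop
      (𝓝 (departures X t ω : ℝ)) := by
  filter_upwards [hX.ae_eventually_gridDescents_eq t] with ω h
  refine tendsto_const_nhds.congr' ?_
  filter_upwards [h] with m hm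
  rw [hm]

theorem IsMarkovChainWithGenerator.integrable_gridDescents [IsProbabilityMeasure P]
    (hX : IsMarkovChainWithGenerator G P X) (t : ℝ≥0) (n : ℕ) :
    Integrable (fun ω => (gridDescents (fun s => X s ω) t n : ℝ)) P :=
  Integrable.of_bound (C := n) (hX.measurable_gridDescents t n).aestronglyMeasurable
    (Eventually.of_forall fun ω => by
      rw [Real.norm_of_nonneg (by positivity)]
      exact_mod_cast gridDescents_le _ t n)

theorem IsMarkovChainWithGenerator.integral_gridDescents [IsProbabilityMeasure P]
    (hX : IsMarkovChainWithGenerator G P X)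
    (hst : Matrix.vecMul (fun i => P.real {ω | X 0 ω = i}) G = 0) (t : ℝ≥0) (n : ℕ) :
    ∫ ω, (gridDescents (fun s => X s ω) t n : ℝ) ∂P =
      (fun i => P.real {ω | X 0 ω = i}) ⬝ᵥ
        Matrix.mulVec (strictLower
          ((n : ℝ) • ((NormedSpace.exp (((t : ℝ) / n) • G) : Matrix _ _ ℝ) - 1))) 1 := by
  rw [strictLower_smul_sub_one, Matrix.smul_mulVec, dotProduct_smul]
  unfold gridDescents
  push_cast
  rw [integral_finsetSum]
  · rw [Finset.sum_eq_card_nsmul, Finset.card_range, ← Nat.cast_smul_eq_nsmul ℝ]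
    intro k hk
    have hn : n ≠ 0 := by
      rintro rfl
      simp at hk
    have h1 : t * ((k : ℝ≥0) / n) ≤ t * (((k + 1 : ℕ) : ℝ≥0) / n) := by
      gcongr
      exact k.le_succ
    have h := hX.integral_descent_mul hst h1 le_rfl 1
    have e1 : ((t * (((k + 1 : ℕ) : ℝ≥0) / n) : ℝ≥0) : ℝ) - ((t * ((k : ℝ≥0) / n) : ℝ≥0) : ℝ)
        = t / n := by
      push_cast
      field_simp
      ring
    rw [e1, sub_self, zero_smul, NormedSpace.exp_zero, Matrix.one_mulVec] at h
    simpa using h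
  · intro k _
    refine Integrable.of_bound (C := 1) (Measurable.aestronglyMeasurable ?_)
      (Eventually.of_forall fun ω => ?_)
    · exact Measurable.ite (measurableSet_lt (hX.measurable _) (hX.measurable _))
        measurable_const measurable_const
    · split_ifs <;> simp

/-- The dyadic descent counts increase to `D(t)`, and their means converge, hence are bounded;
monotone convergence gives a finite mean. -/
theorem IsMarkovChainWithGenerator.integrable_departures [IsProbabilityMeasure P]
    (hX : IsMarkovChainWithGenerator G P X)
    (hst : Matrix.vecMul (fun i => P.real {ω | X 0 ω = i}) G = 0) (t : ℝ≥0) :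
    Integrable (fun ω => (departures X t ω : ℝ)) P := by
  have htwo : Tendsto (fun m : ℕ => 2 ^ m) atTop (atTop : Filter ℕ) :=
    tendsto_pow_atTop_atTop_of_one_lt one_lt_two
  have hcont : Continuous fun A : Matrix (Fin (K + 1)) (Fin (K + 1)) ℝ =>
      (fun i => P.real {ω | X 0 ω = i}) ⬝ᵥ Matrix.mulVec (strictLower A) 1 :=
    continuous_const.dotProduct (continuous_strictLower.matrix_mulVec continuous_const)
  have hlim := ((hcont.tendsto _).comp (tendsto_nat_smul_exp_sub_one G (t : ℝ))).comp htwo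
  obtain ⟨C, hC⟩ := hlim.bddAbove_range
  have hle : ∀ m : ℕ, ∫ ω, (gridDescents (fun s => X s ω) t (2 ^ m) : ℝ) ∂P ≤ C := fun m => by
    rw [hX.integral_gridDescents hst]
    exact hC ⟨m, rfl⟩
  have hmeas : AEStronglyMeasurable (fun ω => (departures X t ω : ℝ)) P :=
    aestronglyMeasurable_of_tendsto_ae atTop
      (fun m => (hX.measurable_gridDescents t (2 ^ m)).aestronglyMeasurable)
      (hX.ae_tendsto_gridDescents t)
  have hmono : Tendsto
      (fun m : ℕ => ∫⁻ ω, ENNReal.ofReal (gridDescents (fun s => X s ω) t (2 ^ m) : ℝ) ∂P) atTop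
      (𝓝 (∫⁻ ω, ENNReal.ofReal (departures X t ω : ℝ) ∂P)) := by
    refine lintegral_tendsto_of_tendsto_of_monotone
      (fun m => (hX.measurable_gridDescents t (2 ^ m)).ennreal_ofReal.aemeasurable)
      (Eventually.of_forall fun ω a b hab => ?_) ?_
    · exact ENNReal.ofReal_le_ofReal
        (by exact_mod_cast monotone_gridDescents_two_pow (fun s => X s ω) t hab)
    · filter_upwards [hX.ae_tendsto_gridDescents t] with ω h
      exact ENNReal.tendsto_ofReal h
  refine ⟨hmeas, ?_⟩
  rw [hasFiniteIntegral_iff_ofReal (Eventually.of_forall fun ω => by positivity)]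
  refine lt_of_le_of_lt (le_of_tendsto' hmono fun m => ?_) (ENNReal.ofReal_lt_top (r := C))
  rw [← ofReal_integral_eq_lintegral_ofReal (hX.integrable_gridDescents t _)
    (Eventually.of_forall fun ω => by positivity)]
  exact ENNReal.ofReal_le_ofReal (hle m)

theorem IsMarkovChainWithGenerator.integrable_departures_mul [IsProbabilityMeasure P]
    (hX : IsMarkovChainWithGenerator G P X)
    (hst : Matrix.vecMul (fun i => P.real {ω | X 0 ω = i}) G = 0) (t : ℝ≥0)
    (g : Fin (K + 1) → ℝ) :
    Integrable (fun ω => (departures X t ω : ℝ) * g (X t ω)) P :=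
  (hX.integrable_departures hst t).mul_bdd (c := ∑ i, |g i|)
    ((measurable_of_finite g).comp (hX.measurable t)).aestronglyMeasurable
    (Eventually.of_forall fun ω => Finset.single_le_sum (f := fun i => |g i|)
      (fun _ _ => abs_nonneg _) (Finset.mem_univ (X t ω)))

/-- The joint moment of the number of downward jumps with a function in the range of the
generator. -/
theorem IsMarkovChainWithGenerator.integral_departures_mul_mulVec [IsProbabilityMeasure P]
    (hX : IsMarkovChainWithGenerator G P X)
    (hst : Matrix.vecMul (fun i => P.real {ω | X 0 ω = i}) G = 0) {t : ℝ≥0} (ht : 0 < t)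
    (w : Fin (K + 1) → ℝ) :
    ∫ ω, (departures X t ω : ℝ) * Matrix.mulVec G w (X t ω) ∂P =
      (fun i => P.real {ω | X 0 ω = i}) ⬝ᵥ Matrix.mulVec (strictLower G)
        (Matrix.mulVec (NormedSpace.exp ((t : ℝ) • G)) w - w) := by
  set θ : Fin (K + 1) → ℝ := fun i => P.real {ω | X 0 ω = i} with hθ
  set g := Matrix.mulVec G w with hg
  have ht' : (t : ℝ) ≠ 0 := by exact_mod_cast ht.ne'
  have htwo : Tendsto (fun m : ℕ => 2 ^ m) atTop (atTop : Filter ℕ) :=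
    tendsto_pow_atTop_atTop_of_one_lt one_lt_two
  have hgb : ∀ i, |g i| ≤ ∑ i, |g i| := fun i =>
    Finset.single_le_sum (f := fun i => |g i|) (fun i _ => abs_nonneg _) (Finset.mem_univ i)
  have hL : Tendsto
      (fun m : ℕ => ∫ ω, (gridDescents (fun s => X s ω) t (2 ^ m) : ℝ) * g (X t ω) ∂P) atTop
      (𝓝 (∫ ω, (departures X t ω : ℝ) * g (X t ω) ∂P)) := by
    refine tendsto_integral_of_dominated_convergence
      (fun ω => (departures X t ω : ℝ) * ∑ i, |g i|) (fun m => ?_)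
      ((hX.integrable_departures hst t).mul_const _) (fun m => ?_) ?_
    · exact ((hX.measurable_gridDescents t _).mul
        ((measurable_of_finite g).comp (hX.measurable t))).aestronglyMeasurable
    · filter_upwards [hX.ae_gridDescents_le_departures t] with ω h
      rw [norm_mul, Real.norm_of_nonneg (by positivity), Real.norm_eq_abs]
      exact mul_le_mul (by exact_mod_cast h m) (hgb _) (abs_nonneg _) (by positivity)
    · filter_upwards [hX.ae_tendsto_gridDescents t] with ω h
      exact h.mul_const _
  -- The two arguments are to be `n(exp(tG/n) - 1)` and the averaged semigroup times `t • G`. The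
  -- factor `t⁻¹` undoes the scaling that turned `G w` into `(t • G) w`, and it later cancels
  -- against `strictLower (t • G)`.
  have hcont : Continuous fun A : Matrix (Fin (K + 1)) (Fin (K + 1)) ℝ ×
      Matrix (Fin (K + 1)) (Fin (K + 1)) ℝ =>
      θ ⬝ᵥ Matrix.mulVec (strictLower A.1) ((t : ℝ)⁻¹ • Matrix.mulVec A.2 w) :=
    continuous_const.dotProduct ((continuous_strictLower.comp continuous_fst).matrix_mulVec
      ((continuous_snd.matrix_mulVec continuous_const).fun_const_smul _))
  have hlim := ((hcont.tendsto _).comp ((tendsto_nat_smul_exp_sub_one G (t : ℝ)).prodMk_nhds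
    (tendsto_average_exp_mul G t.coe_nonneg))).comp htwo
  have hstrict : strictLower ((t : ℝ) • G) = (t : ℝ) • strictLower G := by
    ext i j
    simp only [strictLower, Matrix.of_apply, Matrix.smul_apply]
    split_ifs <;> simp
  refine (tendsto_nhds_unique hL (hlim.congr fun m => ?_)).trans ?_
  · rw [hX.integral_gridDescents_mul hst t (by positivity)]
    simp only [Function.comp_apply]
    congr 2
    rw [hg, Matrix.mulVec_mulVec, mul_smul_comm, Matrix.smul_mulVec, smul_smul,
      inv_mul_cancel₀ ht', one_smul]
  · dsimp only
    rw [hstrict, Matrix.smul_mulVec, Matrix.mulVec_smul, smul_smul, mul_inv_cancel₀ ht', one_smul,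
      Matrix.sub_mulVec, Matrix.one_mulVec]

end Departures

/-! ### The M/M/1/K generator: balance equations, Dirichlet form and ergodicity. -/

section Generator

variable {K : ℕ} {lam mu ρ : ℝ}

/-- Extending vectors to `ℕ` makes the neighbours `i + 1` and `i - 1` available without bounds, so
that sums can be shifted over `Finset.range`. -/
theorem exists_eq_comp_val {n : ℕ} (v : Fin n → ℝ) :
    ∃ V : ℕ → ℝ, v = fun i : Fin n => V i := by
  refine ⟨fun k => if hk : k < n then v ⟨k, hk⟩ else 0, ?_⟩
  funext i
  simp

theorem mm1kGenerator_apply (K : ℕ) (lam mu : ℝ) (i j : Fin (K + 1)) :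
    mm1kGenerator K lam mu i j =
      (if (j : ℕ) = (i : ℕ) + 1 then lam else 0) + (if (i : ℕ) = (j : ℕ) + 1 then mu else 0) +
        (if (j : ℕ) = (i : ℕ) then
          -((if (i : ℕ) < K then lam else 0) + (if 0 < (i : ℕ) then mu else 0)) else 0) := by
  simp only [mm1kGenerator, Matrix.of_apply, Fin.ext_iff]
  by_cases h1 : (j : ℕ) = (i : ℕ) + 1
  · rw [if_pos h1, if_pos h1, if_neg (by omega), if_neg (by omega), add_zero, add_zero]
  · by_cases h2 : (i : ℕ) = (j : ℕ) + 1
    · rw [if_neg h1, if_pos h2, if_neg h1, if_pos h2, if_neg (by omega), add_zero, zero_add]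
    · rw [if_neg h1, if_neg h2, if_neg h1, if_neg h2, zero_add, zero_add]
      simp only [eq_comm]

theorem sum_range_ite_eq_add_one (f : ℕ → ℝ) (N i : ℕ) :
    ∑ j ∈ Finset.range N, (if i = j + 1 then f j else 0) =
      if 0 < i ∧ i ≤ N then f (i - 1) else 0 := by
  rcases i with _ | i
  · simp
  · simp

theorem mm1kGenerator_mulVec (W : ℕ → ℝ) (i : Fin (K + 1)) :
    Matrix.mulVec (mm1kGenerator K lam mu) (fun j => W j) i =
      (if (i : ℕ) < K then lam * (W (i + 1) - W i) else 0) +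
        (if 0 < (i : ℕ) then mu * (W (i - 1) - W i) else 0) := by
  have h : Matrix.mulVec (mm1kGenerator K lam mu) (fun j => W j) i =
      ∑ j ∈ Finset.range (K + 1), ((if j = (i : ℕ) + 1 then lam * W j else 0) +
        (if (i : ℕ) = j + 1 then mu * W j else 0) + (if j = (i : ℕ) then
          -((if (i : ℕ) < K then lam else 0) + (if 0 < (i : ℕ) then mu else 0)) * W j else 0)) := by
    rw [← Fin.sum_univ_eq_sum_range (α := ℝ), Matrix.mulVec, dotProduct]
    refine Finset.sum_congr rfl fun j _ => ?_
    rw [mm1kGenerator_apply, add_mul, add_mul]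
    simp only [ite_mul, zero_mul]
  rw [h, Finset.sum_add_distrib, Finset.sum_add_distrib, sum_range_ite_eq_add_one]
  simp only [Finset.sum_ite_eq', Finset.mem_range]
  have hi : (i : ℕ) < K + 1 := i.2
  simp only [hi, hi.le, if_true, and_true, Nat.add_lt_add_iff_right]
  split_ifs <;> ring

theorem vecMul_mm1kGenerator (T : ℕ → ℝ) (j : Fin (K + 1)) :
    Matrix.vecMul (fun i : Fin (K + 1) => T i) (mm1kGenerator K lam mu) j =
      (if (j : ℕ) < K then mu * T (j + 1) - lam * T j else 0) +
        (if 0 < (j : ℕ) then lam * T (j - 1) - mu * T j else 0) := by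
  have h : Matrix.vecMul (fun i : Fin (K + 1) => T i) (mm1kGenerator K lam mu) j =
      ∑ i ∈ Finset.range (K + 1), ((if (j : ℕ) = i + 1 then lam * T i else 0) +
        (if i = (j : ℕ) + 1 then mu * T i else 0) + (if i = (j : ℕ) then
          -((if (j : ℕ) < K then lam else 0) + (if 0 < (j : ℕ) then mu else 0)) * T i else 0)) := by
    rw [← Fin.sum_univ_eq_sum_range (α := ℝ), Matrix.vecMul, dotProduct]
    refine Finset.sum_congr rfl fun i _ => ?_
    rw [mm1kGenerator_apply, mul_add, mul_add]
    simp only [mul_ite, mul_zero]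
    congr 1
    · simp only [mul_comm]
    · by_cases h1 : (i : ℕ) = j
      · rw [if_pos h1.symm, if_pos h1, h1]
        ring
      · rw [if_neg (Ne.symm h1), if_neg h1]
  rw [h, Finset.sum_add_distrib, Finset.sum_add_distrib, sum_range_ite_eq_add_one]
  simp only [Finset.sum_ite_eq', Finset.mem_range]
  have hj : (j : ℕ) < K + 1 := j.2
  simp only [hj, hj.le, if_true, and_true, Nat.add_lt_add_iff_right]
  split_ifs <;> ring

theorem strictLower_mm1kGenerator_mulVec (W : ℕ → ℝ) (i : Fin (K + 1)) :
    Matrix.mulVec (strictLower (mm1kGenerator K lam mu)) (fun j => W j) i =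
      if 0 < (i : ℕ) then mu * W (i - 1) else 0 := by
  have h : Matrix.mulVec (strictLower (mm1kGenerator K lam mu)) (fun j => W j) i =
      ∑ j ∈ Finset.range (K + 1), (if (i : ℕ) = j + 1 then mu * W j else 0) := by
    rw [← Fin.sum_univ_eq_sum_range (α := ℝ), Matrix.mulVec, dotProduct]
    refine Finset.sum_congr rfl fun j _ => ?_
    simp only [strictLower, Matrix.of_apply, mm1kGenerator_apply, Fin.lt_def]
    by_cases h : (j : ℕ) < i
    · rw [if_pos h, if_neg (show ¬ (j : ℕ) = i + 1 by omega), if_neg (show ¬ (j : ℕ) = i by omega),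
        zero_add, add_zero, ite_mul, zero_mul]
    · rw [if_neg h, if_neg (by omega), zero_mul]
  rw [h, sum_range_ite_eq_add_one]
  simp only [i.2.le, and_true]

/-- Detailed balance determines the stationary law up to normalization. -/
theorem eq_mul_pow_of_vecMul_mm1kGenerator (hmu : 0 < mu) (hρ : ρ = lam / mu)
    {θ : Fin (K + 1) → ℝ} (h : Matrix.vecMul θ (mm1kGenerator K lam mu) = 0) :
    ∃ c, θ = fun i : Fin (K + 1) => c * ρ ^ (i : ℕ) := by
  obtain ⟨T, hθ⟩ := exists_eq_comp_val θ
  -- The balance equation at state `0` is the first cut equation; subtracting the previous cut from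
  -- the balance at `n + 1` gives the next.
  have hbal : ∀ n, n < K → mu * T (n + 1) = lam * T n := by
    intro n
    induction n with
    | zero =>
      intro hn
      have h0 := congrFun h ⟨0, by omega⟩
      rw [hθ, vecMul_mm1kGenerator] at h0
      simp only [hn, if_true, lt_irrefl, if_false, Pi.zero_apply] at h0
      linarith
    | succ n ih =>
      intro hn
      have h0 := congrFun h ⟨n + 1, by omega⟩
      rw [hθ, vecMul_mm1kGenerator] at h0
      simp only [hn, if_true, Nat.succ_pos, Pi.zero_apply, Nat.add_sub_cancel] at h0
      linarith [ih (by omega)]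
  refine ⟨T 0, ?_⟩
  have hpow : ∀ n, n ≤ K → T n = T 0 * ρ ^ n := by
    intro n
    induction n with
    | zero => simp
    | succ n ih =>
      intro hn
      have h1 := hbal n (by omega)
      rw [ih (by omega)] at h1
      rw [pow_succ, hρ] at *
      field_simp at h1 ⊢
      linarith
  rw [hθ]
  funext i
  exact hpow i (Nat.lt_succ_iff.1 i.2)

/-- The Dirichlet form of the queue length. -/
theorem sum_mul_mm1kGenerator_mulVec (hmu : 0 < mu) (hρ : ρ = lam / mu) (c : ℝ) (V W : ℕ → ℝ) :
    ∑ i : Fin (K + 1), c * ρ ^ (i : ℕ) * V i *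
        Matrix.mulVec (mm1kGenerator K lam mu) (fun j => W j) i =
      -(lam * c * ∑ k ∈ Finset.range K, ρ ^ k * ((V (k + 1) - V k) * (W (k + 1) - W k))) := by
  have hlam : lam = mu * ρ := by rw [hρ]; field_simp
  simp only [mm1kGenerator_mulVec]
  rw [Fin.sum_univ_eq_sum_range (fun i => c * ρ ^ i * V i *
    ((if i < K then lam * (W (i + 1) - W i) else 0) +
      (if 0 < i then mu * (W (i - 1) - W i) else 0)))]
  simp only [mul_add]
  rw [Finset.sum_add_distrib, Finset.sum_range_succ]
  rw [Finset.sum_range_succ' _ K]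
  simp only [lt_irrefl, if_false, mul_zero, add_zero, Nat.succ_pos, if_true, Nat.add_sub_cancel]
  rw [← Finset.sum_add_distrib, Finset.mul_sum, ← Finset.sum_neg_distrib]
  refine Finset.sum_congr rfl fun k hk => ?_
  rw [if_pos (Finset.mem_range.1 hk), hlam]
  ring

/-- By detailed balance the flow from `k + 1` down to `k` equals `lam` times the weight of `k`. The
state `K` is never entered from above, hence the missing term. -/
theorem dotProduct_strictLower_mm1kGenerator_mulVec (hmu : 0 < mu) (hρ : ρ = lam / mu) (c : ℝ)
    (v : Fin (K + 1) → ℝ) :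
    (fun i : Fin (K + 1) => c * ρ ^ (i : ℕ)) ⬝ᵥ
        Matrix.mulVec (strictLower (mm1kGenerator K lam mu)) v =
      lam * ((fun i : Fin (K + 1) => c * ρ ^ (i : ℕ)) ⬝ᵥ v - c * ρ ^ K * v (Fin.last K)) := by
  have hlam : lam = mu * ρ := by rw [hρ]; field_simp
  obtain ⟨V, hv⟩ := exists_eq_comp_val v
  rw [hv]
  simp only [dotProduct, strictLower_mm1kGenerator_mulVec, Fin.val_last]
  rw [Fin.sum_univ_eq_sum_range (fun i => c * ρ ^ i * if 0 < i then mu * V (i - 1) else 0),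
    Fin.sum_univ_eq_sum_range (fun i => c * ρ ^ i * V i), Finset.sum_range_succ',
    Finset.sum_range_succ]
  simp only [lt_irrefl, if_false, mul_zero, add_zero, Nat.succ_pos, if_true, Nat.add_sub_cancel,
    add_sub_cancel_right]
  rw [Finset.mul_sum]
  refine Finset.sum_congr rfl fun k _ => ?_
  rw [hlam]
  ring

/-- A Poincaré inequality for geometric weights on an interval of integers. -/
theorem exists_poincare_const (K : ℕ) (hρ : 0 < ρ) {c : ℝ} (hc : 0 < c)
    (hsum : ∑ i ∈ Finset.range (K + 1), c * ρ ^ i = 1) :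
    ∃ C, 0 < C ∧ ∀ U : ℕ → ℝ, ∑ i ∈ Finset.range (K + 1), c * ρ ^ i * U i = 0 →
      ∑ i ∈ Finset.range (K + 1), c * ρ ^ i * U i ^ 2 ≤
        C * ∑ k ∈ Finset.range K, ρ ^ k * (U (k + 1) - U k) ^ 2 := by
  set M : ℝ := ∑ k ∈ Finset.range K, (ρ ^ k)⁻¹ with hM
  have hM0 : 0 ≤ M := Finset.sum_nonneg fun k _ => by positivity
  -- Cauchy–Schwarz along a path of at most `K` edges gives the factor `K`, and `M` dominates every
  -- inverse weight. The `+ 1` keeps the constant positive when `K = 0`.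
  refine ⟨K * M + 1, by positivity, fun U hU => ?_⟩
  set D : ℝ := ∑ k ∈ Finset.range K, ρ ^ k * (U (k + 1) - U k) ^ 2 with hD
  have hD0 : 0 ≤ D := Finset.sum_nonneg fun k _ => by positivity
  have hpt : ∀ i ∈ Finset.range (K + 1), (U i - U 0) ^ 2 ≤ (K * M + 1) * D := by
    intro i hi
    have hiK : i ≤ K := Nat.lt_succ_iff.1 (Finset.mem_range.1 hi)
    have hterm : ∀ k ∈ Finset.range K, (U (k + 1) - U k) ^ 2 ≤ M * (ρ ^ k * (U (k + 1) - U k) ^ 2) := by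
      intro k hk
      have h1 : (ρ ^ k)⁻¹ ≤ M :=
        Finset.single_le_sum (f := fun k => (ρ ^ k)⁻¹) (fun k _ => by positivity) hk
      calc (U (k + 1) - U k) ^ 2 = (ρ ^ k)⁻¹ * (ρ ^ k * (U (k + 1) - U k) ^ 2) := by
            field_simp
        _ ≤ _ := by gcongr
    rw [← Finset.sum_range_sub]
    calc (∑ k ∈ Finset.range i, (U (k + 1) - U k)) ^ 2
        ≤ (Finset.range i).card * ∑ k ∈ Finset.range i, (U (k + 1) - U k) ^ 2 :=
          sq_sum_le_card_mul_sum_sq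
      _ ≤ K * ∑ k ∈ Finset.range K, (U (k + 1) - U k) ^ 2 := by
          rw [Finset.card_range]
          gcongr
      _ ≤ K * ∑ k ∈ Finset.range K, M * (ρ ^ k * (U (k + 1) - U k) ^ 2) := by
          gcongr with k hk
          exact hterm k hk
      _ = K * M * D := by rw [← Finset.mul_sum, mul_assoc]
      _ ≤ _ := by nlinarith
  -- As `U` has mean zero, its variance is at most its second moment about `U 0`.
  have h2 : ∑ i ∈ Finset.range (K + 1), c * ρ ^ i * (U i - U 0) ^ 2 =
      ∑ i ∈ Finset.range (K + 1), c * ρ ^ i * U i ^ 2 + U 0 ^ 2 := by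
    have : ∀ i, c * ρ ^ i * (U i - U 0) ^ 2 =
        c * ρ ^ i * U i ^ 2 - 2 * U 0 * (c * ρ ^ i * U i) + U 0 ^ 2 * (c * ρ ^ i) := by
      intro i
      ring
    simp only [this]
    rw [Finset.sum_add_distrib, Finset.sum_sub_distrib, ← Finset.mul_sum, ← Finset.mul_sum, hU,
      hsum]
    ring
  have h3 : ∑ i ∈ Finset.range (K + 1), c * ρ ^ i * (U i - U 0) ^ 2 ≤ (K * M + 1) * D := by
    calc _ ≤ ∑ i ∈ Finset.range (K + 1), c * ρ ^ i * ((K * M + 1) * D) :=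
          Finset.sum_le_sum fun i hi => by
            have := hpt i hi
            gcongr
      _ = _ := by rw [← Finset.sum_mul, hsum, one_mul]
  nlinarith [sq_nonneg (U 0)]

theorem hasDerivAt_exp_smul_mulVec {S : Type*} [Fintype S] [DecidableEq S]
    (G : Matrix S S ℝ) (w : S → ℝ) (t : ℝ) (i : S) :
    HasDerivAt (fun s : ℝ => Matrix.mulVec (NormedSpace.exp (s • G)) w i)
      (Matrix.mulVec G (Matrix.mulVec (NormedSpace.exp (t • G)) w) i) t := by
  rw [Matrix.mulVec_mulVec]
  exact HasDerivAt.fun_sum fun j _ =>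
    (hasDerivAt_matrix_exp_smul_apply G t i j).mul_const (w j)

/-- Convergence to equilibrium of the semigroup of the M/M/1/K queue. -/
theorem tendsto_exp_mm1kGenerator_mulVec (hlam : 0 < lam) (hmu : 0 < mu) (hρ : ρ = lam / mu)
    {c : ℝ} (hc : 0 < c) (hsum : ∑ i ∈ Finset.range (K + 1), c * ρ ^ i = 1)
    (hst : Matrix.vecMul (fun i : Fin (K + 1) => c * ρ ^ (i : ℕ)) (mm1kGenerator K lam mu) = 0)
    (w : Fin (K + 1) → ℝ) (l : Fin (K + 1)) :
    Tendsto (fun t : ℝ => Matrix.mulVec (NormedSpace.exp (t • mm1kGenerator K lam mu)) w l) atTop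
      (𝓝 ((fun i : Fin (K + 1) => c * ρ ^ (i : ℕ)) ⬝ᵥ w)) := by
  have hρ0 : 0 < ρ := hρ ▸ div_pos hlam hmu
  set G := mm1kGenerator K lam mu with hG
  set θ : Fin (K + 1) → ℝ := fun i => c * ρ ^ (i : ℕ) with hθ
  set u : ℝ → Fin (K + 1) → ℝ :=
    fun t i => Matrix.mulVec (NormedSpace.exp (t • G)) w i - θ ⬝ᵥ w with hu
  choose U huU using fun t => exists_eq_comp_val (u t)
  obtain ⟨C, hC, hpoin⟩ := exists_poincare_const K hρ0 hc hsum
  have hsumF : ∑ i, θ i = 1 := by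
    rw [← hsum, hθ, Fin.sum_univ_eq_sum_range (fun i => c * ρ ^ i)]
  have hmean : ∀ t, ∑ i ∈ Finset.range (K + 1), c * ρ ^ i * U t i = 0 := by
    intro t
    rw [← Fin.sum_univ_eq_sum_range (fun i => c * ρ ^ i * U t i)]
    have h1 : ∑ i : Fin (K + 1), c * ρ ^ (i : ℕ) * U t i = ∑ i, θ i * u t i := by rw [huU]
    have h2 : ∑ i, θ i * Matrix.mulVec (NormedSpace.exp (t • G)) w i = θ ⬝ᵥ w := by
      change θ ⬝ᵥ Matrix.mulVec (NormedSpace.exp (t • G)) w = _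
      rw [Matrix.dotProduct_mulVec, vecMul_exp_smul_of_vecMul_eq_zero hst]
    rw [h1]
    simp only [hu, mul_sub]
    rw [Finset.sum_sub_distrib, h2, ← Finset.sum_mul, hsumF, one_mul, sub_self]
  have hderiv : ∀ t i, HasDerivAt (fun s => u s i) (Matrix.mulVec G (u t) i) t := by
    intro t i
    have h1 := (hasDerivAt_exp_smul_mulVec G w t i).sub_const (θ ⬝ᵥ w)
    have h2 : Matrix.mulVec G (u t) =
        Matrix.mulVec G (Matrix.mulVec (NormedSpace.exp (t • G)) w) := by
      have h3 : u t = Matrix.mulVec (NormedSpace.exp (t • G)) w -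
          fun j : Fin (K + 1) => (fun _ : ℕ => θ ⬝ᵥ w) j := rfl
      have h4 : Matrix.mulVec G (fun j : Fin (K + 1) => (fun _ : ℕ => θ ⬝ᵥ w) j) = 0 := by
        funext j
        exact (mm1kGenerator_mulVec (fun _ => θ ⬝ᵥ w) j).trans (by simp)
      rw [h3, Matrix.mulVec_sub, h4, sub_zero]
    rw [h2]
    exact h1
  set E : ℝ → ℝ := fun t => ∑ i, θ i * u t i ^ 2 with hE
  set D : ℝ → ℝ := fun t => ∑ k ∈ Finset.range K, ρ ^ k * (U t (k + 1) - U t k) ^ 2 with hD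
  have hE' : ∀ t, HasDerivAt E (-(2 * lam * c * D t)) t := by
    intro t
    have h1 : HasDerivAt E (∑ i, θ i * (2 * u t i * Matrix.mulVec G (u t) i)) t := by
      refine HasDerivAt.fun_sum fun i _ => HasDerivAt.const_mul _ ?_
      simpa using (hderiv t i).fun_pow 2
    have h2 : ∑ i, θ i * (2 * u t i * Matrix.mulVec G (u t) i) = -(2 * lam * c * D t) := by
      have := sum_mul_mm1kGenerator_mulVec (K := K) hmu hρ c (U t) (U t)
      simp only [← pow_two] at this
      rw [← huU] at this
      rw [hD]
      dsimp only
      rw [show ∀ x : ℝ, -(2 * lam * c * x) = 2 * -(lam * c * x) by intro x; ring, ← this,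
        Finset.mul_sum]
      refine Finset.sum_congr rfl fun i _ => ?_
      rw [← congrFun (huU t) i, hθ]
      ring
    rw [← h2]
    exact h1
  have hED : ∀ t, E t ≤ C * D t := by
    intro t
    have := hpoin (U t) (hmean t)
    rw [← Fin.sum_univ_eq_sum_range (fun i => c * ρ ^ i * U t i ^ 2)] at this
    refine le_trans (le_of_eq ?_) this
    exact Finset.sum_congr rfl fun i _ => by rw [← congrFun (huU t) i]
  -- The energy satisfies `E' = -2 lam c D` and `E ≤ C D`, hence `E' ≤ -a E` and `E` decays
  -- exponentially at rate `a`.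
  set a : ℝ := 2 * lam * c / C with ha
  have ha0 : 0 < a := by positivity
  have hanti : Antitone fun t => E t * Real.exp (a * t) := by
    have hd : ∀ t, HasDerivAt (fun t => E t * Real.exp (a * t))
        (-(2 * lam * c * D t) * Real.exp (a * t) + E t * (Real.exp (a * t) * a)) t := by
      intro t
      have h1 : HasDerivAt (fun t : ℝ => a * t) a t := by
        simpa using (hasDerivAt_id t).const_mul a
      exact (hE' t).mul h1.exp
    refine antitone_of_deriv_nonpos (fun t => (hd t).differentiableAt) fun t => ?_
    rw [(hd t).deriv]
    have h1 : a * E t ≤ 2 * lam * c * D t := by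
      calc a * E t ≤ a * (C * D t) := by gcongr; exact hED t
        _ = _ := by rw [ha]; field_simp
    nlinarith [Real.exp_pos (a * t)]
  have hElim : Tendsto E atTop (𝓝 0) := by
    have hexp : Tendsto (fun t : ℝ => E 0 * Real.exp (-(a * t))) atTop (𝓝 0) := by
      have := (Real.tendsto_exp_neg_atTop_nhds_zero.comp
        (tendsto_id.const_mul_atTop ha0)).const_mul (E 0)
      simpa using this
    refine squeeze_zero' (Eventually.of_forall fun t =>
      Finset.sum_nonneg fun i _ => by positivity) ?_ hexp
    filter_upwards [eventually_ge_atTop 0] with t ht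
    have := hanti ht
    simp only [mul_zero, Real.exp_zero, mul_one] at this
    rw [Real.exp_neg, ← div_eq_mul_inv, le_div_iff₀ (Real.exp_pos _)]
    exact this
  have hsq : Tendsto (fun t => u t l ^ 2) atTop (𝓝 0) := by
    have hθl : 0 < θ l := by positivity
    have hlim : Tendsto (fun t => (θ l)⁻¹ * E t) atTop (𝓝 0) := by
      simpa using hElim.const_mul (θ l)⁻¹
    refine squeeze_zero (fun t => sq_nonneg _) (fun t => ?_) hlim
    have h1 : θ l * u t l ^ 2 ≤ E t :=
      Finset.single_le_sum (f := fun i => θ i * u t i ^ 2) (fun i _ => by positivity)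
        (Finset.mem_univ l)
    rw [inv_mul_eq_div, le_div_iff₀ hθl, mul_comm]
    exact h1
  have hu0 : Tendsto (fun t => u t l) atTop (𝓝 0) := by
    rw [tendsto_zero_iff_abs_tendsto_zero]
    have := hsq.sqrt
    simpa [Real.sqrt_sq_eq_abs, Function.comp_def] using this
  have := hu0.add_const (θ ⬝ᵥ w)
  simpa [hu] using this

end Generator

/-! ### The covariance formula and explicit Poisson solutions. -/

section Covariance

theorem mul_sum_range_pow (r : ℝ) (n : ℕ) :
    (r - 1) * ∑ j ∈ Finset.range (n + 1), r ^ j = r ^ n * r - 1 := by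
  rw [mul_comm, geom_sum_mul, pow_succ]

theorem mul_sum_range_id_mul_pow (r : ℝ) (n : ℕ) :
    (r - 1) ^ 2 * ∑ j ∈ Finset.range (n + 1), (j : ℝ) * r ^ j =
      n * r ^ n * r ^ 2 - (n + 1) * r ^ n * r + r := by
  induction n with
  | zero => simp
  | succ n ih =>
    rw [Finset.sum_range_succ, mul_add, ih]
    push_cast
    ring

theorem mul_sum_range_choose_mul_pow (r : ℝ) (n : ℕ) :
    (r - 1) ^ 3 * ∑ j ∈ Finset.range (n + 1), (j * (j - 1) / 2 : ℝ) * r ^ j =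
      n * (n - 1) / 2 * r ^ n * r ^ 3 - (n ^ 2 - 1) * r ^ n * r ^ 2 +
        n * (n + 1) / 2 * r ^ n * r - r ^ 2 := by
  induction n with
  | zero => simp
  | succ n ih =>
    rw [Finset.sum_range_succ, mul_add, ih]
    push_cast
    ring

theorem sum_range_cubic (a b d : ℝ) (n : ℕ) :
    ∑ j ∈ Finset.range (n + 1), (a * j + b * j ^ 2 + d * j ^ 3) =
      a * (n * (n + 1) / 2) + b * (n * (n + 1) * (2 * n + 1) / 6) +
        d * (n * (n + 1) / 2) ^ 2 := by
  induction n with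
  | zero => simp
  | succ n ih =>
    rw [Finset.sum_range_succ, ih]
    push_cast
    ring

variable {Ω : Type*} [MeasurableSpace Ω] {P : Measure Ω} [IsProbabilityMeasure P]
  {K : ℕ} {lam mu ρ : ℝ} {Q : ℝ≥0 → Ω → Fin (K + 1)}

theorem IsStationaryMM1K.exists_law (hlam : 0 < lam) (hmu : 0 < mu) (hρ : ρ = lam / mu)
    (hQ : IsStationaryMM1K K lam mu P Q) :
    ∃ c, 0 < c ∧ ∑ i ∈ Finset.range (K + 1), c * ρ ^ i = 1 ∧
      (fun i => P.real {ω | Q 0 ω = i}) = fun i : Fin (K + 1) => c * ρ ^ (i : ℕ) := by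
  obtain ⟨c, hc⟩ := eq_mul_pow_of_vecMul_mm1kGenerator hmu hρ hQ.stationary
  have hρ0 : 0 < ρ := hρ ▸ div_pos hlam hmu
  have hsum : ∑ i ∈ Finset.range (K + 1), c * ρ ^ i = 1 := by
    have h := hQ.markovChain.integral_comp hQ.stationary 0 1
    rw [hc, dotProduct_one, Fin.sum_univ_eq_sum_range (fun i => c * ρ ^ i)] at h
    rw [← h]
    simp
  refine ⟨c, ?_, hsum, hc⟩
  rw [← Finset.mul_sum] at hsum
  exact pos_of_mul_pos_left (hsum ▸ one_pos) (Finset.sum_nonneg fun i _ => by positivity)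

/-- The limiting covariance, in terms of a solution of the Poisson equation for the queue
length. -/
theorem IsStationaryMM1K.tendsto_covariance (hlam : 0 < lam) (hmu : 0 < mu) (hρ : ρ = lam / mu)
    (hQ : IsStationaryMM1K K lam mu P Q) (W : ℕ → ℝ) (m : ℝ)
    (hW : ∀ i : Fin (K + 1),
      Matrix.mulVec (mm1kGenerator K lam mu) (fun j => W j) i = m - (i : ℕ)) :
    ∃ c, ∑ i ∈ Finset.range (K + 1), c * ρ ^ i = 1 ∧
      Tendsto
        (fun t : ℝ≥0 => cov[fun ω => (departures Q t ω : ℝ), fun ω => ((Q t ω : ℕ) : ℝ); P])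
        atTop (𝓝 (lam * (c * ρ ^ K) *
          (∑ i ∈ Finset.range (K + 1), c * ρ ^ i * W i - W K))) := by
  obtain ⟨c, hc, hsum, hlaw⟩ := hQ.exists_law hlam hmu hρ
  have hst := hQ.stationary
  have hst' := hlaw ▸ hst
  set G := mm1kGenerator K lam mu with hG
  set θ : Fin (K + 1) → ℝ := fun i => c * ρ ^ (i : ℕ) with hθ
  set w : Fin (K + 1) → ℝ := fun j => W j with hw
  refine ⟨c, hsum, ?_⟩
  have hmean : θ ⬝ᵥ (fun i : Fin (K + 1) => ((i : ℕ) : ℝ)) = m := by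
    have h1 : θ ⬝ᵥ Matrix.mulVec G w = 0 := by
      rw [Matrix.dotProduct_mulVec, hst', zero_dotProduct]
    have h2 : Matrix.mulVec G w = m • 1 - fun i : Fin (K + 1) => ((i : ℕ) : ℝ) := by
      funext i
      simp [hW]
    have h3 : θ ⬝ᵥ 1 = 1 := by
      rw [dotProduct_one, ← hsum, hθ, Fin.sum_univ_eq_sum_range (fun i => c * ρ ^ i)]
    rw [h2, dotProduct_sub, dotProduct_smul, h3, smul_eq_mul, mul_one] at h1
    linarith
  have hQmean : ∀ t, ∫ ω, ((Q t ω : ℕ) : ℝ) ∂P = m := by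
    intro t
    rw [hQ.markovChain.integral_comp hst t (fun i => ((i : ℕ) : ℝ)), hlaw, hmean]
  have hcov : ∀ t : ℝ≥0, 0 < t →
      cov[fun ω => (departures Q t ω : ℝ), fun ω => ((Q t ω : ℕ) : ℝ); P] =
        lam * (c * ρ ^ K) *
          (Matrix.mulVec (NormedSpace.exp ((t : ℝ) • G)) w (Fin.last K) - W K) := by
    intro t ht
    have h1 := hQ.markovChain.integral_departures_mul_mulVec hst ht w
    -- Invariance of `θ` kills the bulk term, leaving only the contribution of the full state `K`.
    have h2 : θ ⬝ᵥ (Matrix.mulVec (NormedSpace.exp ((t : ℝ) • G)) w - w) = 0 := by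
      rw [dotProduct_sub, Matrix.dotProduct_mulVec, vecMul_exp_smul_of_vecMul_eq_zero hst',
        sub_self]
    rw [hlaw, dotProduct_strictLower_mm1kGenerator_mulVec hmu hρ, ← hθ, h2] at h1
    have h3 : ∫ ω, Matrix.mulVec G w (Q t ω) ∂P = 0 := by
      rw [hQ.markovChain.integral_comp hst t, Matrix.dotProduct_mulVec, hst, zero_dotProduct]
    -- The centred queue length is `-(G w)(Q t)`; this is where the Poisson equation enters.
    have h4 : ∀ ω, ((departures Q t ω : ℝ) - ∫ ω, (departures Q t ω : ℝ) ∂P) *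
        (((Q t ω : ℕ) : ℝ) - ∫ ω, ((Q t ω : ℕ) : ℝ) ∂P) =
        (∫ ω, (departures Q t ω : ℝ) ∂P) * Matrix.mulVec G w (Q t ω) -
          (departures Q t ω : ℝ) * Matrix.mulVec G w (Q t ω) := by
      intro ω
      rw [hQmean, hW]
      ring
    have hint : Integrable (fun ω => Matrix.mulVec G w (Q t ω)) P :=
      Integrable.of_bound (C := ∑ i, |Matrix.mulVec G w i|)
        ((measurable_of_finite (Matrix.mulVec G w)).comp (hQ.markovChain.measurable t)).aestronglyMeasurable
        (Eventually.of_forall fun ω => Finset.single_le_sum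
          (f := fun i => |Matrix.mulVec G w i|) (fun _ _ => abs_nonneg _) (Finset.mem_univ _))
    rw [covariance, integral_congr_ae (Eventually.of_forall h4),
      integral_sub (hint.const_mul _) (hQ.markovChain.integrable_departures_mul hst t _),
      integral_const_mul, h3, h1]
    simp only [Pi.sub_apply, hw, Fin.val_last]
    ring
  have hlim := ((((tendsto_exp_mm1kGenerator_mulVec hlam hmu hρ hc hsum hst' w
    (Fin.last K)).comp (NNReal.tendsto_coe_atTop.2 tendsto_id)).sub_const (W K)).const_mul
      (lam * (c * ρ ^ K)))
  have hdot : θ ⬝ᵥ w = ∑ i ∈ Finset.range (K + 1), c * ρ ^ i * W i :=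
    Fin.sum_univ_eq_sum_range (fun i => c * ρ ^ i * W i) (K + 1)
  rw [← hdot]
  refine hlim.congr' ?_
  filter_upwards [eventually_gt_atTop 0] with t ht
  exact (hcov t ht).symm

/-- The ansatz adds the homogeneous solution `ρ ^ (-n)` to a quadratic. The linear term of the
right-hand side fixes `β`, the boundary at `0` fixes `γ`, and the boundary at `K` fixes `α`. The
defining relations are returned without division. -/
theorem exists_poisson_solution_of_ne_one (K : ℕ) (hmu : 0 < mu) (hρ : ρ = lam / mu)
    (hρ0 : 0 < ρ) (h1 : ρ ≠ 1) :
    ∃ α β γ m : ℝ, lam * (ρ - 1) * β = -ρ ∧ (ρ ^ K * ρ - 1) * α = -β * (K * ρ ^ K * ρ + 1) ∧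
      (ρ - 1) * γ = α - β ∧
      ∀ i : Fin (K + 1), Matrix.mulVec (mm1kGenerator K lam mu)
        (fun j => (fun n : ℕ => α * n + β * (n * (n - 1) / 2) + γ / ρ ^ n) j) i = m - (i : ℕ) := by
  have hρ1 : ρ - 1 ≠ 0 := sub_ne_zero.2 h1
  have hpow : ρ ^ K * ρ - 1 ≠ 0 := by
    rw [← pow_succ, sub_ne_zero]
    exact fun h => h1 ((pow_eq_one_iff_of_nonneg hρ0.le K.succ_ne_zero).1 h)
  have hlam : lam = mu * ρ := by rw [hρ]; field_simp
  have hlam0 : lam ≠ 0 := by rw [hlam]; positivity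
  obtain ⟨β, hβ⟩ : ∃ β, lam * (ρ - 1) * β = -ρ := ⟨-ρ / (lam * (ρ - 1)), by field_simp⟩
  obtain ⟨α, hα⟩ : ∃ α, (ρ ^ K * ρ - 1) * α = -β * (K * ρ ^ K * ρ + 1) :=
    ⟨-β * (K * ρ ^ K * ρ + 1) / (ρ ^ K * ρ - 1), by field_simp⟩
  obtain ⟨γ, hγ⟩ : ∃ γ, (ρ - 1) * γ = α - β := ⟨(α - β) / (ρ - 1), by field_simp⟩
  have hβ' : mu * (ρ - 1) * β = -1 := by
    rw [hlam] at hβ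
    have : ρ * (mu * (ρ - 1) * β + 1) = 0 := by linarith
    rcases mul_eq_zero.1 this with h | h
    · exact absurd h hρ0.ne'
    · linarith
  refine ⟨α, β, γ, (lam - mu) * α + mu * β, hβ, hα, hγ, fun i => ?_⟩
  refine (mm1kGenerator_mulVec
    (fun n : ℕ => α * n + β * (n * (n - 1) / 2) + γ / ρ ^ n) i).trans ?_
  have hup : ∀ n : ℕ, lam * ((α * (n + 1 : ℕ) + β * ((n + 1 : ℕ) * ((n + 1 : ℕ) - 1) / 2) +
      γ / ρ ^ (n + 1)) - (α * n + β * (n * (n - 1) / 2) + γ / ρ ^ n)) =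
      lam * (α + β * n) - mu * (α - β) / ρ ^ n := by
    intro n
    rw [← hγ, hlam]
    push_cast
    field_simp
    ring
  have hdown : ∀ n : ℕ, 0 < n → mu * ((α * (n - 1 : ℕ) +
      β * ((n - 1 : ℕ) * ((n - 1 : ℕ) - 1) / 2) +
      γ / ρ ^ (n - 1)) - (α * n + β * (n * (n - 1) / 2) + γ / ρ ^ n)) =
      -(mu * (α + β * (n - 1))) + mu * (α - β) / ρ ^ n := by
    intro n hn
    obtain ⟨n, rfl⟩ := Nat.exists_eq_succ_of_ne_zero hn.ne'
    rw [← hγ, Nat.succ_eq_add_one, Nat.add_sub_cancel]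
    push_cast
    field_simp
    ring
  have hbulk : ∀ x : ℝ, lam * (α + β * x) - mu * (α + β * (x - 1)) =
      (lam - mu) * α + mu * β - x := by
    intro x
    have : (lam - mu) * β = -1 := by rw [hlam, ← hβ']; ring
    linear_combination x * this
  -- `hleft` and `hright` say that the formal downward term at `0` and upward term at `K` vanish, so
  -- the bulk equation also holds at both ends.
  have hleft : -(mu * (α + β * (0 - 1))) + mu * (α - β) / ρ ^ 0 = 0 := by
    rw [pow_zero]
    ring
  have hright : lam * (α + β * K) - mu * (α - β) / ρ ^ K = 0 := by
    rw [hlam]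
    field_simp
    linear_combination mu * hα
  split_ifs with hK h0 h0
  · rw [hup, hdown _ h0, ← hbulk]
    ring
  · have hi : (i : ℕ) = 0 := by omega
    rw [hup, ← hbulk, hi]
    push_cast
    linear_combination hleft
  · have hi : (i : ℕ) = K := by have := i.2; omega
    rw [hdown _ h0, ← hbulk, hi]
    linear_combination -hright
  · have hi : (i : ℕ) = 0 := by omega
    have hi' : K = 0 := by omega
    subst hi'
    rw [← hbulk, hi]
    push_cast at hright ⊢
    linear_combination hleft - hright

/-- Summing the equation once gives the increments `(n + 1)(K - n) / (2 lam)`, which vanish at `n =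
-1` and `n = K` as the two boundaries require; summing again gives the cubic. -/
theorem poisson_solution_of_eq (K : ℕ) (hlam : 0 < lam) (i : Fin (K + 1)) :
    Matrix.mulVec (mm1kGenerator K lam lam) (fun j => (fun n : ℕ =>
      (K * n + (K - 1) * (n * (n - 1) / 2) - n * (n - 1) * (2 * n - 1) / 6) / (2 * lam)) j) i =
      K / 2 - (i : ℕ) := by
  refine (mm1kGenerator_mulVec (fun n : ℕ =>
    (K * n + (K - 1) * (n * (n - 1) / 2) - n * (n - 1) * (2 * n - 1) / 6) / (2 * lam)) i).trans ?_
  have hl := hlam.ne'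
  rcases h : (i : ℕ) with _ | n
  · rw [if_neg (lt_irrefl 0)]
    split_ifs with h1
    · push_cast
      field_simp
      ring
    · have : K = 0 := by omega
      subst this
      simp at *
  · rw [Nat.add_sub_cancel, if_pos n.succ_pos]
    split_ifs with h1
    · push_cast
      field_simp
      ring
    · have : n + 1 = K := by have := i.2; omega
      rw [← this]
      push_cast
      field_simp
      ring

end Covariance

/-! ### Evaluation of the limit in closed form. -/

theorem mainTheorem8 {Ω : Type*} [MeasurableSpace Ω] (P : Measure Ω) [IsProbabilityMeasure P]
    (K : ℕ) (lam mu ρ : ℝ) (hlam : 0 < lam) (hmu : 0 < mu) (hρ : ρ = lam / mu)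
    (Q : ℝ≥0 → Ω → Fin (K + 1)) (hQ : IsStationaryMM1K K lam mu P Q) :
    (∀ t : ℝ≥0, Integrable (fun ω => (departures Q t ω : ℝ)) P) ∧
    (ρ ≠ 1 →
      Tendsto
        (fun t : ℝ≥0 => cov[fun ω => (departures Q t ω : ℝ), fun ω => ((Q t ω : ℕ) : ℝ); P])
        atTop
        (𝓝 (ρ ^ (K + 1) *
          (((K : ℝ) ^ 2 * (ρ - 1) ^ 2 * (1 + 3 * ρ ^ (K + 1))
              - 2 * ρ * (ρ ^ K - 1) * (-2 + ρ + ρ ^ (K + 2)))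
              / (2 * (ρ - 1) ^ 2 * (ρ ^ (K + 1) - 1) ^ 3)
            + ((K : ℝ) * (ρ - 1) * (-1 + 3 * ρ - 7 * ρ ^ (K + 1) + 5 * ρ ^ (K + 2)))
              / (2 * (ρ - 1) ^ 2 * (ρ ^ (K + 1) - 1) ^ 3))))) ∧
    (ρ = 1 →
      Tendsto
        (fun t : ℝ≥0 => cov[fun ω => (departures Q t ω : ℝ), fun ω => ((Q t ω : ℕ) : ℝ); P])
        atTop
        (𝓝 (-((K : ℝ) * ((K : ℝ) + 2)) / 24))) := by
  have hρ0 : 0 < ρ := hρ ▸ div_pos hlam hmu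
  refine ⟨hQ.markovChain.integrable_departures hQ.stationary, fun h1 => ?_, fun h1 => ?_⟩
  · obtain ⟨α, β, γ, m, hβ, hα, hγ, hW⟩ :=
      exists_poisson_solution_of_ne_one K hmu hρ hρ0 h1
    obtain ⟨c, hc, hlim⟩ := hQ.tendsto_covariance hlam hmu hρ
      (fun n : ℕ => α * n + β * (n * (n - 1) / 2) + γ / ρ ^ n) m hW
    convert hlim using 2
    have hρ1 : ρ - 1 ≠ 0 := sub_ne_zero.2 h1
    have hpow : ρ ^ K * ρ - 1 ≠ 0 := by
      rw [← pow_succ, sub_ne_zero]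
      exact fun h => h1 ((pow_eq_one_iff_of_nonneg hρ0.le K.succ_ne_zero).1 h)
    -- The weight `ρ ^ i` cancels the homogeneous part `γ / ρ ^ i`, which therefore contributes `γ
    -- (K + 1)`.
    have hsum : ∑ i ∈ Finset.range (K + 1),
        c * ρ ^ i * (α * i + β * (i * (i - 1) / 2) + γ / ρ ^ i) =
        c * (α * ∑ i ∈ Finset.range (K + 1), (i : ℝ) * ρ ^ i +
          β * ∑ i ∈ Finset.range (K + 1), (i * (i - 1) / 2 : ℝ) * ρ ^ i + γ * (K + 1)) := by
      have : (K + 1 : ℝ) = ∑ i ∈ Finset.range (K + 1), (1 : ℝ) := by simp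
      rw [this, Finset.mul_sum, Finset.mul_sum, Finset.mul_sum, ← Finset.sum_add_distrib,
        ← Finset.sum_add_distrib, Finset.mul_sum]
      refine Finset.sum_congr rfl fun i _ => ?_
      field_simp
    have hA0 := mul_sum_range_pow ρ K
    have hA1 := mul_sum_range_id_mul_pow ρ K
    have hA2 := mul_sum_range_choose_mul_pow ρ K
    rw [hsum]
    rw [← Finset.mul_sum] at hc
    have hX : 0 < ρ ^ K := by positivity
    rw [pow_succ, pow_add ρ K 2]
    generalize ∑ i ∈ Finset.range (K + 1), ρ ^ i = A0 at *
    generalize ∑ i ∈ Finset.range (K + 1), (i : ℝ) * ρ ^ i = A1 at *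
    generalize ∑ i ∈ Finset.range (K + 1), (i * (i - 1) / 2 : ℝ) * ρ ^ i = A2 at *
    -- With `ρ ^ K` as an indeterminate and all sums eliminated, the claim is an identity of
    -- rational functions in `ρ`, `X`, `K` and `lam`.
    generalize ρ ^ K = X at *
    obtain rfl : c = (ρ - 1) / (X * ρ - 1) := by
      rw [eq_div_iff hpow, ← hA0]
      linear_combination (ρ - 1) * hc
    obtain rfl : A1 = (K * X * ρ ^ 2 - (K + 1) * X * ρ + ρ) / (ρ - 1) ^ 2 := by
      rw [← hA1]; field_simp
    obtain rfl : A2 = (K * (K - 1) / 2 * X * ρ ^ 3 - (K ^ 2 - 1) * X * ρ ^ 2 +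
        K * (K + 1) / 2 * X * ρ - ρ ^ 2) / (ρ - 1) ^ 3 := by
      rw [← hA2]; field_simp
    obtain rfl : γ = (α - β) / (ρ - 1) := by rw [← hγ]; field_simp
    obtain rfl : α = -β * (K * X * ρ + 1) / (X * ρ - 1) := by rw [← hα]; field_simp
    obtain rfl : β = -ρ / (lam * (ρ - 1)) := by rw [← hβ]; field_simp
    have hl := hlam.ne'
    field_simp
    ring
  · have hlm : mu = lam := by
      rw [h1] at hρ
      field_simp at hρ
      exact hρ
    subst hlm
    obtain ⟨c, hc, hlim⟩ := hQ.tendsto_covariance hlam hmu hρ (fun n : ℕ =>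
    (K * n + (K - 1) * (n * (n - 1) / 2) - n * (n - 1) * (2 * n - 1) / 6) / (2 * mu)) _ (poisson_solution_of_eq K hlam)
    convert hlim using 2
    subst h1
    simp only [one_pow, mul_one] at hc ⊢
    rw [← Finset.mul_sum]
    have hsum : ∑ i ∈ Finset.range (K + 1), (K * i + (K - 1) * (i * (i - 1) / 2) -
        i * (i - 1) * (2 * i - 1) / 6 : ℝ) / (2 * mu) =
        (∑ i ∈ Finset.range (K + 1), ((K - (K - 1) / 2 - 1 / 6 : ℝ) * i +
          ((K - 1) / 2 + 1 / 2 : ℝ) * i ^ 2 + (-1 / 3 : ℝ) * i ^ 3)) / (2 * mu) := by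
      rw [Finset.sum_div]
      refine Finset.sum_congr rfl fun i _ => ?_
      ring
    rw [hsum, sum_range_cubic]
    rw [Finset.sum_const, Finset.card_range, nsmul_eq_mul] at hc
    push_cast at hc
    have hK : (K + 1 : ℝ) ≠ 0 := by positivity
    obtain rfl : c = 1 / (K + 1) := by rw [eq_div_iff hK]; linarith
    field_simp
    ring
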